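/- Let $\rho\in(-1,1)$ and let $\nu_1,\nu_2>0$ be real. Let $(Z_1,Z_2)$ be bivariate normal with zero means, unit variances and correlation $\rho$, let $S$ be uniform on $(0,1)$ and independent of $(Z_1,Z_2)$, and put $W_k=\sqrt{\nu_k/\chi^{-1}_{\nu_k}(S)}$ and $U_k=t_{\nu_k}(W_kZ_k)$ for $k=1,2$, where $\chi^{-1}_{\nu}$ is the inverse distribution function of the chi-square law with $\nu$ degrees of freedom and $t_\nu$ is the distribution function of the Student $t$ law with $\nu$ degrees of freedom. The law of $(U_1,U_2)$ is the bivariate $t$ copula with degrees of freedom $\nu_1,\nu_2$ and correlation $\rho$. Then its lower and upper tail dependence coefficients $$\lambda_L=\lim_{q\to0^+}\frac{\Pr(U_1\le q,\,U_2\le q)}{q},\qquad \lambda_U=\lim_{q\to1^-}\frac{\Pr(U_1>q,\,U_2>q)}{1-q}$$ both exist and $$\lambda_L=\lambda_U=\Omega(\rho,\nu_1,\nu_2)+\Omega(\rho,\nu_2,\nu_1),$$ where $$\Omega(\rho,\nu_1,\nu_2)=\int_0^\infty g_{\nu_1+1}(t)\,F_N\!\left(-\frac{B_{\nu_1,\nu_2}\,t^{\nu_1/(2\nu_2)}-\rho\sqrt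 t}{\sqrt{1-\rho^2}}\right)dt$$ (a convergent integral), $$B_{\nu_1,\nu_2}=\left(\frac{2^{\nu_2/2}\,\Gamma\!\left(\frac{1+\nu_2}{2}\right)}{2^{\nu_1/2}\,\Gamma\!\left(\frac{1+\nu_1}{2}\right)}\right)^{1/\nu_2},\qquad g_\nu(t)=\frac{1}{2^{\nu/2}\Gamma(\nu/2)}\,e^{-t/2}\,t^{\nu/2-1},$$ and $F_N$ is the standard normal distribution function. Moreover, for every real $\nu>0$, $$\Omega(\rho,\nu,\nu)+\Omega(\rho,\nu,\nu)=2\,t_{\nu+1}\!\left(-\sqrt{\frac{(\nu+1)(1-\rho)}{1+\rho}}\right),$$ so for $\nu_1=\nu_2=\nu$ the coefficient is the classical one of the standard $t$ copula. -/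

import Mathlib

open MeasureTheory ProbabilityTheory Set Filter Topology

noncomputable section

namespace MultiDofT

/-- Chi-square density `g_ν` with `ν` degrees of freedom, on the positive half-line. -/
def chiSqPdf (ν t : ℝ) : ℝ :=
  1 / (2 ^ (ν / 2) * Real.Gamma (ν / 2)) * Real.exp (-t / 2) * t ^ (ν / 2 - 1)

/-- Chi-square law with `ν` degrees of freedom: the gamma law of shape `ν / 2` and rate `1 / 2`. -/
def chiSq (ν : ℝ) : Measure ℝ := gammaMeasure (ν / 2) (1 / 2)

lemma gammaPDFReal_eq_chiSqPdf (ν : ℝ) {t : ℝ} (ht : 0 ≤ t) :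
    gammaPDFReal (ν / 2) (1 / 2) t = chiSqPdf ν t := by
  have h : -(1 / 2 * t) = -t / 2 := by ring
  rw [gammaPDFReal, if_pos ht, chiSqPdf, h, Real.div_rpow zero_le_one zero_le_two, Real.one_rpow]
  ring

/-- Inverse cumulative distribution function of the chi-square law with `ν` degrees of freedom. -/
def chiSqInv (ν s : ℝ) : ℝ := sInf {x : ℝ | s ≤ cdf (chiSq ν) x}

/-- The mixing variable `W = √(ν / χ_ν⁻¹(s))` as a function of the uniform variable `s`. -/
def mixW (ν s : ℝ) : ℝ := √(ν / chiSqInv ν s)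

/-- Density `f_ν` of the univariate Student t distribution. -/
def studentPdf (ν x : ℝ) : ℝ :=
  (1 + x ^ 2 / ν) ^ (-(ν + 1) / 2) * Real.Gamma ((ν + 1) / 2) /
    (Real.Gamma (ν / 2) * √(ν * Real.pi))

/-- Distribution function `t_ν` of the univariate Student t distribution. -/
def studentCdf (ν x : ℝ) : ℝ := ∫ y in Iic x, studentPdf ν y

/-- Standard normal distribution function `F_N`. -/
def normalCdf (x : ℝ) : ℝ := cdf (gaussianReal 0 1) x

/-- Law of `(Z₁, Z₂)`: bivariate normal, zero means, unit variances, correlation `ρ`. -/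
def bivNormal (ρ : ℝ) : Measure (EuclideanSpace ℝ (Fin 2)) :=
  multivariateGaussian 0 !![1, ρ; ρ, 1]

/-- Joint law of `(S, Z)`, with `S` uniform on `(0, 1)` and independent of `Z = (Z₁, Z₂)`. -/
def baseLaw (ρ : ℝ) : Measure (ℝ × EuclideanSpace ℝ (Fin 2)) :=
  (volume.restrict (Ioo (0 : ℝ) 1)).prod (bivNormal ρ)

/-- `(U₁, U₂) = (t_{ν₁}(W₁ Z₁), t_{ν₂}(W₂ Z₂))` as a function of `(S, Z)`; the same `S` drives
`W₁` and `W₂`. -/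
def copulaVec (ν₁ ν₂ : ℝ) (p : ℝ × EuclideanSpace ℝ (Fin 2)) : ℝ × ℝ :=
  (studentCdf ν₁ (mixW ν₁ p.1 * p.2 0), studentCdf ν₂ (mixW ν₂ p.1 * p.2 1))

/-- The bivariate t copula with degrees of freedom `ν₁`, `ν₂` and correlation `ρ`: the law of
`(U₁, U₂)`. -/
def copulaLaw (ρ ν₁ ν₂ : ℝ) : Measure (ℝ × ℝ) := (baseLaw ρ).map (copulaVec ν₁ ν₂)

/-- Copula distribution function `C(u₁, u₂) = P(U₁ ≤ u₁, U₂ ≤ u₂)` of a law `μ` of `(U₁, U₂)`. -/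
def jointCdf (μ : Measure (ℝ × ℝ)) (u₁ u₂ : ℝ) : ℝ := μ.real (Iic u₁ ×ˢ Iic u₂)

/-- `P(U₁ > u₁, U₂ > u₂)` for a law `μ` of `(U₁, U₂)`. -/
def jointSurvival (μ : Measure (ℝ × ℝ)) (u₁ u₂ : ℝ) : ℝ := μ.real (Ioi u₁ ×ˢ Ioi u₂)

/-- The lower tail dependence coefficient of `μ` exists and equals `l`. -/
def HasLowerTDC (μ : Measure (ℝ × ℝ)) (l : ℝ) : Prop :=
  Tendsto (fun q : ℝ => jointCdf μ q q / q) (𝓝[>] 0) (𝓝 l)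

/-- The upper tail dependence coefficient of `μ` exists and equals `l`. -/
def HasUpperTDC (μ : Measure (ℝ × ℝ)) (l : ℝ) : Prop :=
  Tendsto (fun q : ℝ => jointSurvival μ q q / (1 - q)) (𝓝[<] 1) (𝓝 l)

/-- The constant `B_{ν₁, ν₂}`. -/
def tailB (ν₁ ν₂ : ℝ) : ℝ :=
  ((2 ^ (ν₂ / 2) * Real.Gamma ((1 + ν₂) / 2)) /
    (2 ^ (ν₁ / 2) * Real.Gamma ((1 + ν₁) / 2))) ^ (1 / ν₂)

/-- The integrand of `Ω(ρ, ν₁, ν₂)`. -/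
def omegaIntegrand (ρ ν₁ ν₂ t : ℝ) : ℝ :=
  chiSqPdf (ν₁ + 1) t *
    normalCdf (-(tailB ν₁ ν₂ * t ^ (ν₁ / (2 * ν₂)) - ρ * √t) / √(1 - ρ ^ 2))

/-- `Ω(ρ, ν₁, ν₂)`. -/
def tailOmega (ρ ν₁ ν₂ : ℝ) : ℝ := ∫ t in Ioi (0 : ℝ), omegaIntegrand ρ ν₁ ν₂ t

end MultiDofT

end

namespace MultiDofT

/-! Write `q = t_{ν_k}(-a_k)`. Given `Z = z`, the event `W_k z_k ≤ -a_k` says `S ≤ F_k(ν_k (z_k⁻ /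
a_k)²)`, where `F_k` is the chi-square distribution function and `z⁻ = max (-z) 0`
(`mixW_mul_le_iff`). The same `S` drives both coordinates, so the conditional probability of the
joint event is the minimum of the two bounds, and `C(q, q)` is the expectation of this minimum
(`jointCdf_copulaLaw`).

Both `F_ν(x) ∼ κ x^{ν/2}` at zero and `t_ν(-a) ∼ c a^{-ν}` at infinity are power laws. Hence each
bound divided by `q` tends to `(z_k⁻)^{ν_k} / C_{ν_k}` with `C_ν = 𝔼[(Z⁻)^ν]`
(`tendsto_condTail_div`), and dominated convergence gives `λ_L` as the expectation of the minimum of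
the two limits.

Split this expectation by which limit is smaller (`integral_min_limitTail`). Where it is the first,
put `Z₁ = -x` and `Z₂ = -ρ x + √(1 - ρ²) V` with `V` standard normal and independent of `x`; the
condition becomes an upper bound on `V`, and `t = x²` turns the integral into `Ω(ρ, ν₁, ν₂)`. The
other half is symmetric.

The law of `Z` is invariant under `z ↦ -z`, which gives `λ_U = λ_L`. For equal degrees of freedom,
`Ω` is the representation of `t_{ν+1}` as a chi-square mixture of normal laws. -/

/-! ### The Student law as a chi-square mixture of normal laws. -/

lemma chiSqPdf_nonneg {n : ℝ} (hn : 0 < n) {t : ℝ} (ht : 0 ≤ t) : 0 ≤ chiSqPdf n t := by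
  have := Real.Gamma_pos_of_pos (half_pos hn)
  unfold chiSqPdf
  positivity

lemma measurable_chiSqPdf (n : ℝ) : Measurable (chiSqPdf n) := by
  unfold chiSqPdf
  fun_prop

lemma lintegral_chiSqPdf {n : ℝ} (hn : 0 < n) :
    ∫⁻ t in Ioi (0 : ℝ), ENNReal.ofReal (chiSqPdf n t) = 1 := by
  have h := lintegral_gammaPDF_eq_one (half_pos hn) (one_half_pos (α := ℝ))
  rw [← lintegral_add_compl _ (measurableSet_Ici (a := (0 : ℝ))), compl_Ici,
    lintegral_gammaPDF_of_nonpos le_rfl, add_zero,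
    setLIntegral_congr Ioi_ae_eq_Ici.symm] at h
  rw [← h]
  refine setLIntegral_congr_fun measurableSet_Ioi fun t ht => ?_
  rw [gammaPDF, gammaPDFReal_eq_chiSqPdf n (le_of_lt ht)]

lemma integrableOn_chiSqPdf {n : ℝ} (hn : 0 < n) : IntegrableOn (chiSqPdf n) (Ioi 0) := by
  refine ⟨(measurable_chiSqPdf n).aestronglyMeasurable, ?_⟩
  rw [hasFiniteIntegral_iff_ofReal, lintegral_chiSqPdf hn]
  · exact ENNReal.one_lt_top
  · exact (ae_restrict_iff' measurableSet_Ioi).2 (ae_of_all _ fun t ht =>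
      chiSqPdf_nonneg hn (le_of_lt ht))

lemma studentPdf_nonneg {n : ℝ} (hn : 0 < n) (y : ℝ) : 0 ≤ studentPdf n y := by
  have h1 := Real.Gamma_pos_of_pos (half_pos hn)
  have h2 : 0 < Real.Gamma ((n + 1) / 2) := Real.Gamma_pos_of_pos (by linarith)
  unfold studentPdf
  positivity

lemma studentPdf_pos {n : ℝ} (hn : 0 < n) (y : ℝ) : 0 < studentPdf n y := by
  have h1 := Real.Gamma_pos_of_pos (half_pos hn)
  have h2 : 0 < Real.Gamma ((n + 1) / 2) := Real.Gamma_pos_of_pos (by linarith)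
  have h3 := Real.pi_pos
  unfold studentPdf
  positivity

lemma measurable_studentPdf (n : ℝ) : Measurable (studentPdf n) := by
  unfold studentPdf
  fun_prop

/-- The product of the chi-square density and the density of the conditional normal law is
proportional to a gamma density. -/
lemma chiSqPdf_mul_gaussianPDFReal {n : ℝ} (hn : 0 < n) (y : ℝ) {t : ℝ} (ht : 0 < t) :
    chiSqPdf n t * gaussianPDFReal 0 (n / t).toNNReal y =
      1 / (2 ^ (n / 2) * Real.Gamma (n / 2)) * (√(2 * Real.pi * n))⁻¹ *
        (t ^ ((n + 1) / 2 - 1) * Real.exp (-((1 + y ^ 2 / n) / 2 * t))) := by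
  have hp := Real.pi_pos
  rw [gaussianPDFReal, chiSqPdf, Real.coe_toNNReal _ (by positivity)]
  have e1 : √(2 * Real.pi * (n / t)) = √(2 * Real.pi * n) / √t := by
    rw [← Real.sqrt_div (by positivity)]; congr 1; ring
  have e2 : t ^ ((n + 1) / 2 - 1) = t ^ (n / 2 - 1) * √t := by
    rw [Real.sqrt_eq_rpow, ← Real.rpow_add ht]; congr 1; ring
  have e3 : Real.exp (-((1 + y ^ 2 / n) / 2 * t)) =
      Real.exp (-t / 2) * Real.exp (-(y - 0) ^ 2 / (2 * (n / t))) := by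
    rw [← Real.exp_add]; congr 1; field_simp; ring
  rw [e1, e2, e3, inv_div]
  ring

lemma integral_chiSqPdf_mul_gaussianPDFReal {n : ℝ} (hn : 0 < n) (y : ℝ) :
    ∫ t in Ioi (0 : ℝ), chiSqPdf n t * gaussianPDFReal 0 (n / t).toNNReal y = studentPdf n y := by
  have hp := Real.pi_pos
  rw [setIntegral_congr_fun measurableSet_Ioi
    (fun t ht => chiSqPdf_mul_gaussianPDFReal hn y (mem_Ioi.1 ht)), integral_const_mul,
    Real.integral_rpow_mul_exp_neg_mul_Ioi (by linarith) (by positivity), studentPdf]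
  have h0 : (0 : ℝ) < 1 + y ^ 2 / n := by positivity
  have h1 := Real.Gamma_pos_of_pos (half_pos hn)
  have e1 : (1 / ((1 + y ^ 2 / n) / 2)) ^ ((n + 1) / 2) =
      (2 ^ (n / 2) * √2) * (1 + y ^ 2 / n) ^ (-(n + 1) / 2) := by
    rw [one_div_div, Real.div_rpow zero_le_two h0.le, Real.sqrt_eq_rpow,
      ← Real.rpow_add zero_lt_two, neg_div, Real.rpow_neg h0.le]
    congr 2; ring
  have e2 : √(2 * Real.pi * n) = √2 * √(n * Real.pi) := by
    rw [← Real.sqrt_mul zero_le_two]; congr 1; ring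
  rw [e1, e2]
  have h2 : (0 : ℝ) < 2 ^ (n / 2) := by positivity
  have h3 : 0 < √(n * Real.pi) := by positivity
  field_simp

lemma integrableOn_chiSqPdf_mul_gaussianPDFReal {n : ℝ} (hn : 0 < n) (y : ℝ) :
    IntegrableOn (fun t => chiSqPdf n t * gaussianPDFReal 0 (n / t).toNNReal y) (Ioi 0) := by
  -- A non-integrable function has integral `0` by convention, whereas the value found above is a
  -- positive density.
  by_contra h
  have := integral_chiSqPdf_mul_gaussianPDFReal hn y
  rw [integral_undef h] at this
  exact (studentPdf_pos hn y).ne this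

/-- Tonelli applied to the pointwise mixture. `A = univ` yields the total mass and `A = Iic x` the
distribution function. -/
lemma lintegral_studentPdf {n : ℝ} (hn : 0 < n) (A : Set ℝ) :
    ∫⁻ y in A, ENNReal.ofReal (studentPdf n y) =
      ∫⁻ t in Ioi (0 : ℝ), ENNReal.ofReal (chiSqPdf n t) *
        gaussianReal 0 (n / t).toNNReal A := by
  have h1 : ∀ y, ENNReal.ofReal (studentPdf n y) = ∫⁻ t in Ioi (0 : ℝ),
      ENNReal.ofReal (chiSqPdf n t) * gaussianPDF 0 (n / t).toNNReal y := fun y => by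
    rw [← integral_chiSqPdf_mul_gaussianPDFReal hn y, ofReal_integral_eq_lintegral_ofReal
      (integrableOn_chiSqPdf_mul_gaussianPDFReal hn y)]
    · refine setLIntegral_congr_fun measurableSet_Ioi fun t ht => ?_
      rw [ENNReal.ofReal_mul (chiSqPdf_nonneg hn (le_of_lt ht)), gaussianPDF]
    · exact (ae_restrict_iff' measurableSet_Ioi).2 (ae_of_all _ fun t ht =>
        mul_nonneg (chiSqPdf_nonneg hn (le_of_lt ht)) (gaussianPDFReal_nonneg _ _ _))
  simp_rw [h1]
  rw [lintegral_lintegral_swap]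
  · refine setLIntegral_congr_fun measurableSet_Ioi fun t ht => ?_
    have hv : (n / t).toNNReal ≠ 0 := (Real.toNNReal_pos.2 (div_pos hn ht)).ne'
    rw [gaussianReal_apply _ hv, lintegral_const_mul _ (measurable_gaussianPDF _ _)]
  · have hm := measurable_chiSqPdf n
    have hg : Measurable fun p : ℝ × ℝ => gaussianPDF 0 (n / p.2).toNNReal p.1 :=
      measurable_uncurry_gaussianPDF.comp
        (measurable_const.prodMk (((measurable_const.div measurable_snd).real_toNNReal).prodMk
          measurable_fst))
    exact ((hm.comp measurable_snd).ennreal_ofReal.mul hg).aemeasurable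

lemma gaussianReal_Iic_eq_normalCdf {n : ℝ} (hn : 0 < n) {t : ℝ} (ht : 0 < t) (x : ℝ) :
    gaussianReal 0 (n / t).toNNReal (Iic x) = ENNReal.ofReal (normalCdf (x * √(t / n))) := by
  have h := gaussianReal_map_const_mul (μ := 0) (v := 1) (√(n / t))
  have hv : (NNReal.mk (√(n / t) ^ 2) (sq_nonneg _) * 1) = (n / t).toNNReal := by
    ext
    simp [Real.sq_sqrt (div_pos hn ht).le, (div_pos hn ht).le]
  rw [mul_zero, hv] at h
  rw [← h, Measure.map_apply (by fun_prop) measurableSet_Iic, normalCdf, ofReal_cdf]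
  congr 1
  ext z
  have hs : 0 < √(n / t) := Real.sqrt_pos.2 (div_pos hn ht)
  have : √(t / n) = (√(n / t))⁻¹ := by rw [← Real.sqrt_inv, inv_div]
  rw [mem_preimage, mem_Iic, mem_Iic, this, ← div_eq_mul_inv, le_div_iff₀ hs, mul_comm]

lemma lintegral_studentPdf_univ {n : ℝ} (hn : 0 < n) :
    ∫⁻ y, ENNReal.ofReal (studentPdf n y) = 1 := by
  rw [← setLIntegral_univ, lintegral_studentPdf hn]
  simpa using lintegral_chiSqPdf hn

lemma integrable_studentPdf {n : ℝ} (hn : 0 < n) : Integrable (studentPdf n) := by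
  refine ⟨(measurable_studentPdf n).aestronglyMeasurable, ?_⟩
  rw [hasFiniteIntegral_iff_ofReal (ae_of_all _ (studentPdf_nonneg hn)),
    lintegral_studentPdf_univ hn]
  exact ENNReal.one_lt_top

lemma integral_studentPdf {n : ℝ} (hn : 0 < n) : ∫ y, studentPdf n y = 1 := by
  rw [integral_eq_lintegral_of_nonneg_ae (ae_of_all _ (studentPdf_nonneg hn))
    (measurable_studentPdf n).aestronglyMeasurable, lintegral_studentPdf_univ hn,
    ENNReal.toReal_one]

lemma normalCdf_nonneg (x : ℝ) : 0 ≤ normalCdf x := cdf_nonneg _ _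

lemma normalCdf_le_one (x : ℝ) : normalCdf x ≤ 1 := cdf_le_one _ _

lemma measurable_normalCdf : Measurable normalCdf := (monotone_cdf _).measurable

/-- The Student law as a chi-square mixture of normal laws. -/
lemma studentCdf_eq_integral {n : ℝ} (hn : 0 < n) (x : ℝ) :
    studentCdf n x = ∫ t in Ioi (0 : ℝ), chiSqPdf n t * normalCdf (x * √(t / n)) := by
  have hm := measurable_chiSqPdf n
  have hN := measurable_normalCdf
  rw [studentCdf, integral_eq_lintegral_of_nonneg_ae (ae_of_all _ (studentPdf_nonneg hn))
    (measurable_studentPdf n).aestronglyMeasurable, lintegral_studentPdf hn,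
    integral_eq_lintegral_of_nonneg_ae]
  · congr 1
    refine setLIntegral_congr_fun measurableSet_Ioi fun t ht => ?_
    rw [gaussianReal_Iic_eq_normalCdf hn ht, ENNReal.ofReal_mul (chiSqPdf_nonneg hn (le_of_lt ht))]
  · exact (ae_restrict_iff' measurableSet_Ioi).2 (ae_of_all _ fun t ht =>
        mul_nonneg (chiSqPdf_nonneg hn (le_of_lt ht)) (normalCdf_nonneg _))
  · exact Measurable.aestronglyMeasurable (by fun_prop)

/-! ### The integral `Ω` and the case of equal degrees of freedom. -/

lemma measurable_omegaIntegrand (ρ ν₁ ν₂ : ℝ) : Measurable (omegaIntegrand ρ ν₁ ν₂) := by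
  have hm := measurable_chiSqPdf (ν₁ + 1)
  have hN := measurable_normalCdf
  unfold omegaIntegrand
  fun_prop

lemma integrableOn_omegaIntegrand (ρ ν₂ : ℝ) {ν₁ : ℝ} (h₁ : 0 < ν₁) :
    IntegrableOn (omegaIntegrand ρ ν₁ ν₂) (Ioi 0) := by
  refine Integrable.mono (integrableOn_chiSqPdf (by linarith : 0 < ν₁ + 1))
    (measurable_omegaIntegrand ρ ν₁ ν₂).aestronglyMeasurable (ae_of_all _ fun t => ?_)
  rw [omegaIntegrand, norm_mul, Real.norm_of_nonneg (normalCdf_nonneg _)]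
  exact mul_le_of_le_one_right (norm_nonneg _) (normalCdf_le_one _)

lemma tailB_self {ν : ℝ} (hν : 0 < ν) : tailB ν ν = 1 := by
  have : 0 < Real.Gamma ((1 + ν) / 2) := Real.Gamma_pos_of_pos (by linarith)
  rw [tailB, div_self (by positivity), Real.one_rpow]

/-- With `B = 1` and exponent `1/2` the normal argument is `-√t √((1 - ρ) / (1 + ρ))`, so the
integrand is that of `studentCdf_eq_integral` with `ν + 1` degrees of freedom. -/
lemma tailOmega_self {ρ : ℝ} (hρ : -1 < ρ) (hρ' : ρ < 1) {ν : ℝ} (hν : 0 < ν) :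
    tailOmega ρ ν ν = studentCdf (ν + 1) (-√((ν + 1) * (1 - ρ) / (1 + ρ))) := by
  rw [studentCdf_eq_integral (by linarith), tailOmega]
  refine setIntegral_congr_fun measurableSet_Ioi fun t ht => ?_
  rw [mem_Ioi] at ht
  have e : ν / (2 * ν) = 1 / 2 := by field_simp
  simp only [omegaIntegrand]
  rw [tailB_self hν, e, ← Real.sqrt_eq_rpow]
  have h1 : 0 < 1 - ρ := by linarith
  have h2 : 0 < 1 + ρ := by linarith
  have h3 : 0 < ν + 1 := by linarith
  congr 2
  rw [neg_div, neg_mul, neg_inj, ← Real.sqrt_mul (by positivity)]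
  have e1 : 1 * √t - ρ * √t = √(t * (1 - ρ) ^ 2) := by
    rw [Real.sqrt_mul ht.le, Real.sqrt_sq h1.le]; ring
  rw [e1, ← Real.sqrt_div (by positivity)]
  congr 1
  have : 1 - ρ ^ 2 = (1 - ρ) * (1 + ρ) := by ring
  rw [this]
  field_simp

/-! ### Monotonicity, symmetry and tail of the Student distribution function. -/

lemma studentCdf_sub {n : ℝ} (hn : 0 < n) (a b : ℝ) :
    studentCdf n b - studentCdf n a = ∫ y in a..b, studentPdf n y :=
  intervalIntegral.integral_Iic_sub_Iic (integrable_studentPdf hn).integrableOn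
    (integrable_studentPdf hn).integrableOn

lemma strictMono_studentCdf {n : ℝ} (hn : 0 < n) : StrictMono (studentCdf n) := fun a b hab => by
  have := studentCdf_sub hn a b
  have h2 := intervalIntegral.intervalIntegral_pos_of_pos
    ((integrable_studentPdf hn).intervalIntegrable (a := a) (b := b)) (studentPdf_pos hn) hab
  linarith

lemma continuous_studentCdf {n : ℝ} (hn : 0 < n) : Continuous (studentCdf n) := by
  have h : studentCdf n = fun x => studentCdf n 0 + ∫ y in (0 : ℝ)..x, studentPdf n y := by
    ext x
    rw [← studentCdf_sub hn]; ring
  rw [h]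
  exact continuous_const.add (intervalIntegral.continuous_primitive
    (fun _ _ => (integrable_studentPdf hn).intervalIntegrable) 0)

lemma studentPdf_neg (n y : ℝ) : studentPdf n (-y) = studentPdf n y := by
  simp [studentPdf]

lemma studentCdf_neg_eq_integral_Ioi (n x : ℝ) :
    studentCdf n (-x) = ∫ y in Ioi x, studentPdf n y := by
  rw [studentCdf, ← integral_comp_neg_Ioi]
  simp_rw [studentPdf_neg]

lemma studentCdf_neg {n : ℝ} (hn : 0 < n) (x : ℝ) : studentCdf n (-x) = 1 - studentCdf n x := by
  rw [studentCdf_neg_eq_integral_Ioi, ← integral_studentPdf hn,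
    ← integral_add_compl measurableSet_Iic (integrable_studentPdf hn) (s := Iic x), compl_Iic,
    studentCdf]
  ring

/-- The constant `c` in the tail asymptotics `t_ν(-a) ∼ c a^{-ν}`. -/
noncomputable def studentTailConst (ν : ℝ) : ℝ :=
  ν ^ ((ν + 1) / 2) * Real.Gamma ((ν + 1) / 2) / (Real.Gamma (ν / 2) * √(ν * Real.pi)) / ν

lemma studentTailConst_pos {n : ℝ} (hn : 0 < n) : 0 < studentTailConst n := by
  have h1 := Real.Gamma_pos_of_pos (half_pos hn)
  have h2 : 0 < Real.Gamma ((n + 1) / 2) := Real.Gamma_pos_of_pos (by linarith)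
  have h3 := Real.pi_pos
  unfold studentTailConst
  positivity

/-- Isolates the pure power tail. The remaining factor increases to `1`, so on `Ioi a` it lies
between its value at `a` and `1`; this gives the two-sided tail bounds below. -/
lemma studentPdf_eq_rpow_mul {n : ℝ} (hn : 0 < n) {y : ℝ} (hy : 0 < y) :
    studentPdf n y =
      (1 + n / y ^ 2) ^ (-(n + 1) / 2) * (studentTailConst n * n * y ^ (-n - 1)) := by
  have e : 1 + y ^ 2 / n = (1 + n / y ^ 2) * y ^ 2 * n⁻¹ := by field_simp; ring
  have e1 : (y ^ 2) ^ (-(n + 1) / 2) = y ^ (-n - 1) := by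
    rw [← Real.rpow_natCast, ← Real.rpow_mul hy.le]; congr 1; push_cast; ring
  have e2 : n⁻¹ ^ (-(n + 1) / 2) = n ^ ((n + 1) / 2) := by
    rw [Real.inv_rpow hn.le, ← Real.rpow_neg hn.le]; congr 1; ring
  rw [studentPdf, e, Real.mul_rpow (by positivity) (by positivity),
    Real.mul_rpow (by positivity) (by positivity), e1, e2, studentTailConst]
  field_simp

lemma integral_Ioi_rpow_tail {n : ℝ} (hn : 0 < n) {a : ℝ} (ha : 0 < a) :
    ∫ y in Ioi a, studentTailConst n * n * y ^ (-n - 1) = studentTailConst n * a ^ (-n) := by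
  rw [integral_const_mul, integral_Ioi_rpow_of_lt (by linarith) ha]
  have : -n - 1 + 1 = -n := by ring
  rw [this]
  field_simp

lemma integrableOn_Ioi_rpow_tail {n : ℝ} (hn : 0 < n) {a : ℝ} (ha : 0 < a) :
    IntegrableOn (fun y => studentTailConst n * n * y ^ (-n - 1)) (Ioi a) :=
  (integrableOn_Ioi_rpow_of_lt (by linarith) ha).const_mul _

lemma studentCdf_neg_le {n : ℝ} (hn : 0 < n) {a : ℝ} (ha : 0 < a) :
    studentCdf n (-a) ≤ studentTailConst n * a ^ (-n) := by
  rw [studentCdf_neg_eq_integral_Ioi, ← integral_Ioi_rpow_tail hn ha]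
  refine setIntegral_mono_on (integrable_studentPdf hn).integrableOn
    (integrableOn_Ioi_rpow_tail hn ha) measurableSet_Ioi fun y hy => ?_
  have hy0 : 0 < y := ha.trans hy
  have hc := studentTailConst_pos hn
  rw [studentPdf_eq_rpow_mul hn hy0]
  refine mul_le_of_le_one_left (by positivity)
    (Real.rpow_le_one_of_one_le_of_nonpos ?_ (by linarith))
  have : 0 < n / y ^ 2 := by positivity
  linarith

lemma le_studentCdf_neg {n : ℝ} (hn : 0 < n) {a : ℝ} (ha : 0 < a) :
    (1 + n / a ^ 2) ^ (-(n + 1) / 2) * (studentTailConst n * a ^ (-n)) ≤ studentCdf n (-a) := by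
  rw [studentCdf_neg_eq_integral_Ioi, ← integral_Ioi_rpow_tail hn ha, ← integral_const_mul]
  refine setIntegral_mono_on ((integrableOn_Ioi_rpow_tail hn ha).const_mul _)
    (integrable_studentPdf hn).integrableOn measurableSet_Ioi fun y hy => ?_
  have hy0 : 0 < y := ha.trans hy
  have hc := studentTailConst_pos hn
  rw [studentPdf_eq_rpow_mul hn hy0]
  refine mul_le_mul_of_nonneg_right ?_ (by positivity)
  refine Real.rpow_le_rpow_of_nonpos (by positivity) ?_ (by linarith)
  have : y ^ 2 ≥ a ^ 2 := by
    have := mem_Ioi.1 hy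
    gcongr
  gcongr

lemma studentCdf_pos {n : ℝ} (hn : 0 < n) (x : ℝ) : 0 < studentCdf n x := by
  -- The lower tail bound needs a positive argument; this point is also at most `x`.
  have h : 0 < studentCdf n (-(max (-x) 1)) := by
    have h1 : 0 < max (-x) 1 := lt_max_of_lt_right one_pos
    have hc := studentTailConst_pos hn
    exact lt_of_lt_of_le (by positivity) (le_studentCdf_neg hn h1)
  refine h.trans_le ((strictMono_studentCdf hn).monotone ?_)
  have := le_max_left (-x) 1
  linarith

lemma tendsto_studentCdf_mul_rpow {n : ℝ} (hn : 0 < n) :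
    Tendsto (fun a => studentCdf n (-a) * a ^ n) atTop (𝓝 (studentTailConst n)) := by
  have h0 : Tendsto (fun a : ℝ => 1 + n / a ^ 2) atTop (𝓝 1) := by
    simpa using ((tendsto_const_nhds (x := n)).div_atTop
      (tendsto_pow_atTop (α := ℝ) two_ne_zero)).const_add 1
  have h1 := (h0.rpow_const (p := -(n + 1) / 2) (Or.inl one_ne_zero)).mul_const (studentTailConst n)
  rw [Real.one_rpow, one_mul] at h1
  refine tendsto_of_tendsto_of_tendsto_of_le_of_le' h1 tendsto_const_nhds ?_ ?_
  all_goals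
    filter_upwards [eventually_gt_atTop 0] with a ha
    have e : a ^ (-n) * a ^ n = 1 := by rw [← Real.rpow_add ha]; simp
    have hp : 0 < a ^ n := by positivity
  · have := mul_le_mul_of_nonneg_right (le_studentCdf_neg hn ha) hp.le
    rwa [mul_assoc, mul_assoc, e, mul_one] at this
  · have := mul_le_mul_of_nonneg_right (studentCdf_neg_le hn ha) hp.le
    rwa [mul_assoc, e, mul_one] at this

/-- For small `q` the equation `t_ν(-a) = q` has a positive solution. -/
lemma exists_studentCdf_neg_eq {n : ℝ} (hn : 0 < n) {q : ℝ} (hq : 0 < q)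
    (hq' : q < studentCdf n 0) : ∃ a, 0 < a ∧ studentCdf n (-a) = q := by
  have ht : Tendsto (fun a : ℝ => studentTailConst n * a ^ (-n)) atTop (𝓝 0) := by
    simpa using (tendsto_rpow_neg_atTop hn).const_mul (studentTailConst n)
  obtain ⟨b, hb, hb0⟩ := ((ht.eventually_lt_const hq).and (eventually_gt_atTop 0)).exists
  have hbq := (studentCdf_neg_le hn hb0).trans_lt hb
  obtain ⟨x, hx, hxq⟩ := intermediate_value_Icc (by linarith : -b ≤ 0)
    (continuous_studentCdf hn).continuousOn ⟨hbq.le, hq'.le⟩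
  refine ⟨-x, ?_, by rwa [neg_neg]⟩
  have : x < 0 := (strictMono_studentCdf hn).lt_iff_lt.1 (hxq.trans_lt hq')
  linarith

/-! ### The chi-square distribution function near zero and its inverse. -/

/-- The constant `κ` in `F(x) ∼ κ x^{ν/2}` for the chi-square distribution function. -/
noncomputable def chiSqConst (ν : ℝ) : ℝ := 1 / (2 ^ (ν / 2) * Real.Gamma (ν / 2)) * (2 / ν)

lemma chiSqConst_pos {n : ℝ} (hn : 0 < n) : 0 < chiSqConst n := by
  have h1 := Real.Gamma_pos_of_pos (half_pos hn)
  unfold chiSqConst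
  positivity

lemma cdf_chiSq {n : ℝ} (hn : 0 < n) (x : ℝ) :
    cdf (chiSq n) x = ∫ t in Ioc 0 x, chiSqPdf n t := by
  rw [chiSq, cdf_gammaMeasure_eq_integral (half_pos hn) one_half_pos]
  have h1 : ∫ t in Ioc 0 x, chiSqPdf n t = ∫ t in Ioc 0 x, gammaPDFReal (n / 2) (1 / 2) t :=
    setIntegral_congr_fun measurableSet_Ioc fun t ht => (gammaPDFReal_eq_chiSqPdf n ht.1.le).symm
  rw [h1, setIntegral_congr_set (Ioc_ae_eq_Icc (a := (0 : ℝ)) (b := x))]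
  refine setIntegral_eq_of_subset_of_forall_sdiff_eq_zero measurableSet_Iic Icc_subset_Iic_self
    fun t ht => ?_
  have : ¬ 0 ≤ t := fun h => ht.2 ⟨h, ht.1⟩
  simp [gammaPDFReal, this]

lemma integral_Ioc_chiSqConst {n : ℝ} (hn : 0 < n) {x : ℝ} (hx : 0 ≤ x) :
    ∫ t in Ioc 0 x, 1 / (2 ^ (n / 2) * Real.Gamma (n / 2)) * t ^ (n / 2 - 1) =
      chiSqConst n * x ^ (n / 2) := by
  rw [integral_const_mul, ← intervalIntegral.integral_of_le hx,
    integral_rpow (Or.inl (by linarith)), chiSqConst, sub_add_cancel,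
    Real.zero_rpow (by positivity), sub_zero]
  field_simp

lemma integrableOn_Ioc_chiSqConst {n : ℝ} (hn : 0 < n) {x : ℝ} (hx : 0 ≤ x) :
    IntegrableOn (fun t => 1 / (2 ^ (n / 2) * Real.Gamma (n / 2)) * t ^ (n / 2 - 1)) (Ioc 0 x) :=
  ((intervalIntegrable_iff_integrableOn_Ioc_of_le hx).1
    (intervalIntegral.intervalIntegrable_rpow' (by linarith))).const_mul _

/-- On `Ioc 0 x` the exponential factor of the density lies between `exp (-x / 2)` and `1`; the
upper bound is used here, the lower one in `le_cdf_chiSq`. -/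
lemma cdf_chiSq_le {n : ℝ} (hn : 0 < n) {x : ℝ} (hx : 0 ≤ x) :
    cdf (chiSq n) x ≤ chiSqConst n * x ^ (n / 2) := by
  have hG := Real.Gamma_pos_of_pos (half_pos hn)
  rw [cdf_chiSq hn, ← integral_Ioc_chiSqConst hn hx]
  refine setIntegral_mono_on ((integrableOn_chiSqPdf hn).mono_set Ioc_subset_Ioi_self)
    (integrableOn_Ioc_chiSqConst hn hx) measurableSet_Ioc fun t ht => ?_
  have ht0 := ht.1
  have : Real.exp (-t / 2) ≤ 1 := Real.exp_le_one_iff.2 (by linarith)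
  rw [chiSqPdf]
  gcongr
  exact mul_le_of_le_one_right (by positivity) this

lemma le_cdf_chiSq {n : ℝ} (hn : 0 < n) {x : ℝ} (hx : 0 ≤ x) :
    Real.exp (-x / 2) * (chiSqConst n * x ^ (n / 2)) ≤ cdf (chiSq n) x := by
  have hG := Real.Gamma_pos_of_pos (half_pos hn)
  rw [cdf_chiSq hn, ← integral_Ioc_chiSqConst hn hx, ← integral_const_mul]
  refine setIntegral_mono_on ((integrableOn_Ioc_chiSqConst hn hx).const_mul _)
    ((integrableOn_chiSqPdf hn).mono_set Ioc_subset_Ioi_self) measurableSet_Ioc fun t ht => ?_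
  have ht0 := ht.1
  have : Real.exp (-x / 2) ≤ Real.exp (-t / 2) := Real.exp_le_exp.2 (by linarith [ht.2])
  rw [chiSqPdf, ← mul_assoc, mul_comm (Real.exp (-x / 2))]
  gcongr

lemma cdf_chiSq_zero {n : ℝ} (hn : 0 < n) : cdf (chiSq n) 0 = 0 := by
  rw [cdf_chiSq hn]; simp

lemma cdf_chiSq_nonpos {n : ℝ} (hn : 0 < n) {x : ℝ} (hx : x ≤ 0) : cdf (chiSq n) x = 0 :=
  le_antisymm ((monotone_cdf _ hx).trans_eq (cdf_chiSq_zero hn)) (cdf_nonneg _ _)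

lemma bddBelow_chiSq_superlevel {n : ℝ} (hn : 0 < n) {s : ℝ} (hs : 0 < s) :
    BddBelow {x : ℝ | s ≤ cdf (chiSq n) x} := by
  refine ⟨0, fun x hx => ?_⟩
  by_contra! h
  have := cdf_chiSq_nonpos hn h.le
  replace hx : s ≤ cdf (chiSq n) x := hx
  linarith

lemma nonempty_chiSq_superlevel (n : ℝ) {s : ℝ} (hs : s < 1) :
    {x : ℝ | s ≤ cdf (chiSq n) x}.Nonempty :=
  ((tendsto_cdf_atTop (chiSq n)).eventually (eventually_ge_nhds hs)).exists

/-- Right continuity makes the infimum attained; `0 < s < 1` keeps the set bounded below and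
nonempty. -/
lemma chiSqInv_le_iff {n : ℝ} (hn : 0 < n) {s : ℝ} (hs : s ∈ Ioo (0 : ℝ) 1) (x : ℝ) :
    chiSqInv n s ≤ x ↔ s ≤ cdf (chiSq n) x := by
  refine ⟨fun h => ?_, fun h => csInf_le (bddBelow_chiSq_superlevel hn hs.1) h⟩
  have key : ∀ y, x < y → s ≤ cdf (chiSq n) y := fun y hy => by
    obtain ⟨z, hz, hzy⟩ := exists_lt_of_csInf_lt (nonempty_chiSq_superlevel n hs.2)
      (h.trans_lt hy)
    exact le_trans hz (monotone_cdf _ hzy.le)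
  have hc : Tendsto (cdf (chiSq n)) (𝓝[>] x) (𝓝 (cdf (chiSq n) x)) :=
    ((cdf (chiSq n)).right_continuous x).mono_left (nhdsWithin_mono _ Ioi_subset_Ici_self)
  exact ge_of_tendsto hc (eventually_nhdsWithin_of_forall key)

lemma chiSqInv_pos {n : ℝ} (hn : 0 < n) {s : ℝ} (hs : s ∈ Ioo (0 : ℝ) 1) : 0 < chiSqInv n s := by
  by_contra! h
  have := (chiSqInv_le_iff hn hs 0).1 h
  rw [cdf_chiSq_zero hn] at this
  exact absurd hs.1 this.not_gt

lemma monotoneOn_chiSqInv {n : ℝ} (hn : 0 < n) : MonotoneOn (chiSqInv n) (Ioo 0 1) :=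
  fun _ hs _ ht hst => (chiSqInv_le_iff hn hs _).2
    (hst.trans ((chiSqInv_le_iff hn ht _).1 le_rfl))

/-! ### Conditional tail probabilities and the diagonal of the copula. -/

/-- The probability, given `Z = z`, that `W_ν Z ≤ -a`. -/
noncomputable def condTail (ν a z : ℝ) : ℝ := cdf (chiSq ν) (ν * (max (-z) 0 / a) ^ 2)

/-- `C_ν = 𝔼[(Z⁻)^ν]` for a standard normal variable `Z`. -/
noncomputable def normalMoment (ν : ℝ) : ℝ :=
  2 ^ (ν / 2) * Real.Gamma ((1 + ν) / 2) / (2 * √Real.pi)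

/-- The limit of `P(W_ν Z ≤ -a | Z = z) / t_ν(-a)` as `a → ∞`. -/
noncomputable def limitTail (ν z : ℝ) : ℝ := max (-z) 0 ^ ν / normalMoment ν

lemma normalMoment_pos {n : ℝ} (hn : 0 < n) : 0 < normalMoment n := by
  have h2 : 0 < Real.Gamma ((1 + n) / 2) := Real.Gamma_pos_of_pos (by linarith)
  have h3 := Real.pi_pos
  unfold normalMoment
  positivity

lemma limitTail_nonneg {n : ℝ} (hn : 0 < n) (z : ℝ) : 0 ≤ limitTail n z := by
  have := normalMoment_pos hn
  have : 0 ≤ max (-z) 0 := le_max_right _ _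
  unfold limitTail
  positivity

lemma measurable_limitTail (n : ℝ) : Measurable (limitTail n) := by
  unfold limitTail
  fun_prop

lemma measurable_condTail (n a : ℝ) : Measurable (condTail n a) := by
  have : Measurable (cdf (chiSq n)) := (monotone_cdf _).measurable
  unfold condTail
  fun_prop

lemma condTail_nonneg (n a z : ℝ) : 0 ≤ condTail n a z := cdf_nonneg _ _

lemma condTail_le_one (n a z : ℝ) : condTail n a z ≤ 1 := cdf_le_one _ _

/-- A small `s` means a small chi-square quantile, hence a large `W`. For `z ≥ 0` both sides are
false, since truncation at `0` makes the right-hand bound vanish. -/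
lemma mixW_mul_le_iff {n : ℝ} (hn : 0 < n) {s : ℝ} (hs : s ∈ Ioo (0 : ℝ) 1) {a : ℝ} (ha : 0 < a)
    (z : ℝ) : mixW n s * z ≤ -a ↔ s ≤ condTail n a z := by
  have hw : 0 ≤ mixW n s := Real.sqrt_nonneg _
  rcases le_or_gt 0 z with hz | hz
  · have h1 : ¬ mixW n s * z ≤ -a := by
      have := mul_nonneg hw hz
      linarith
    have h2 : condTail n a z = 0 := by
      simp [condTail, max_eq_right (neg_nonpos.2 hz), cdf_chiSq_zero hn]
    simp only [h1, h2, false_iff, not_le, hs.1]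
  · have hy := chiSqInv_pos hn hs
    rw [condTail, max_eq_left (by linarith), ← chiSqInv_le_iff hn hs]
    have e : mixW n s * z ≤ -a ↔ a / (-z) ≤ mixW n s := by
      rw [div_le_iff₀ (by linarith)]
      constructor <;> intro h <;> linarith
    rw [e, mixW, Real.le_sqrt' (div_pos ha (by linarith)), div_pow, div_le_div_iff₀
      (by nlinarith) hy, div_pow, ← mul_div_assoc, le_div_iff₀ (by positivity), mul_comm]

lemma aemeasurable_mixW {n : ℝ} (hn : 0 < n) :
    AEMeasurable (mixW n) (volume.restrict (Ioo (0 : ℝ) 1)) :=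
  (aemeasurable_const.div
    (aemeasurable_restrict_of_monotoneOn measurableSet_Ioo (monotoneOn_chiSqInv hn))).sqrt

instance isProbabilityMeasure_bivNormal (ρ : ℝ) : IsProbabilityMeasure (bivNormal ρ) := by
  unfold bivNormal
  infer_instance

lemma aemeasurable_copulaVec (ρ : ℝ) {ν₁ ν₂ : ℝ} (h₁ : 0 < ν₁) (h₂ : 0 < ν₂) :
    AEMeasurable (copulaVec ν₁ ν₂) (baseLaw ρ) := by
  have key : ∀ (n : ℝ) (_ : 0 < n) (i : Fin 2), AEMeasurable
      (fun p : ℝ × EuclideanSpace ℝ (Fin 2) => studentCdf n (mixW n p.1 * p.2 i)) (baseLaw ρ) := by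
    intro n hn i
    refine (continuous_studentCdf hn).measurable.comp_aemeasurable ?_
    refine AEMeasurable.mul (aemeasurable_mixW hn).comp_fst ?_
    exact Measurable.aemeasurable (by fun_prop)
  exact (key ν₁ h₁ 0).prodMk (key ν₂ h₂ 1)

lemma ae_baseLaw_fst_mem (ρ : ℝ) : ∀ᵐ p ∂(baseLaw ρ), p.1 ∈ Ioo (0 : ℝ) 1 :=
  Measure.quasiMeasurePreserving_fst.ae (ae_restrict_mem measurableSet_Ioo)

lemma volume_restrict_Ioo_le_min {u v : ℝ} (hu : u ≤ 1) :
    (volume.restrict (Ioo (0 : ℝ) 1)) {s | s ≤ u ∧ s ≤ v} = ENNReal.ofReal (min u v) := by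
  have e : {s : ℝ | s ≤ u ∧ s ≤ v} = Iic (min u v) := by ext; simp
  rw [e, Measure.restrict_congr_set Ioo_ae_eq_Ioc, Measure.restrict_apply measurableSet_Iic,
    inter_comm, Ioc_inter_Iic, min_eq_right ((min_le_left u v).trans hu), Real.volume_Ioc, sub_zero]

/-- The diagonal of the copula as an expectation over `Z`, the uniform variable being integrated
out. -/
lemma jointCdf_copulaLaw (ρ : ℝ) {ν₁ ν₂ : ℝ} (h₁ : 0 < ν₁) (h₂ : 0 < ν₂) {q a₁ a₂ : ℝ}
    (ha₁ : 0 < a₁) (ha₂ : 0 < a₂) (hq₁ : studentCdf ν₁ (-a₁) = q) (hq₂ : studentCdf ν₂ (-a₂) = q) :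
    jointCdf (copulaLaw ρ ν₁ ν₂) q q =
      ∫ z, min (condTail ν₁ a₁ (z 0)) (condTail ν₂ a₂ (z 1)) ∂(bivNormal ρ) := by
  have m₁ := measurable_condTail ν₁ a₁
  have m₂ := measurable_condTail ν₂ a₂
  have hset : MeasurableSet {p : ℝ × EuclideanSpace ℝ (Fin 2) |
      p.1 ≤ condTail ν₁ a₁ (p.2 0) ∧ p.1 ≤ condTail ν₂ a₂ (p.2 1)} :=
    MeasurableSet.inter
      (s₁ := {p : ℝ × EuclideanSpace ℝ (Fin 2) | p.1 ≤ condTail ν₁ a₁ (p.2 0)})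
      (s₂ := {p : ℝ × EuclideanSpace ℝ (Fin 2) | p.1 ≤ condTail ν₂ a₂ (p.2 1)})
      (measurableSet_le (by fun_prop) (by fun_prop)) (measurableSet_le (by fun_prop) (by fun_prop))
  have hae : copulaVec ν₁ ν₂ ⁻¹' (Iic q ×ˢ Iic q) =ᵐ[baseLaw ρ]
      {p : ℝ × EuclideanSpace ℝ (Fin 2) |
        p.1 ≤ condTail ν₁ a₁ (p.2 0) ∧ p.1 ≤ condTail ν₂ a₂ (p.2 1)} := by
    refine eventuallyEq_set.2 ?_
    filter_upwards [ae_baseLaw_fst_mem ρ] with p hp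
    have e₁ : studentCdf ν₁ (mixW ν₁ p.1 * p.2 0) ≤ q ↔ p.1 ≤ condTail ν₁ a₁ (p.2 0) := by
      rw [← hq₁, (strictMono_studentCdf h₁).le_iff_le, mixW_mul_le_iff h₁ hp ha₁]
    have e₂ : studentCdf ν₂ (mixW ν₂ p.1 * p.2 1) ≤ q ↔ p.1 ≤ condTail ν₂ a₂ (p.2 1) := by
      rw [← hq₂, (strictMono_studentCdf h₂).le_iff_le, mixW_mul_le_iff h₂ hp ha₂]
    exact and_congr e₁ e₂
  rw [jointCdf, measureReal_def, copulaLaw, Measure.map_apply_of_aemeasurable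
    (aemeasurable_copulaVec ρ h₁ h₂) (measurableSet_Iic.prod measurableSet_Iic),
    -- Integrating over `S` first, at fixed `z`, leaves the length of an interval.
    measure_congr hae, baseLaw, Measure.prod_apply_symm hset,
    integral_eq_lintegral_of_nonneg_ae (ae_of_all _ fun z =>
      le_min (condTail_nonneg _ _ _) (condTail_nonneg _ _ _))
      (Measurable.aestronglyMeasurable (by fun_prop))]
  congr 1
  refine lintegral_congr fun z => ?_
  exact volume_restrict_Ioo_le_min (v := condTail ν₂ a₂ (z 1)) (condTail_le_one ν₁ a₁ (z 0))

/-! ### Limit and domination of the conditional tail ratios. -/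

lemma rpow_half_mul_sq {n : ℝ} (hn : 0 < n) {m a : ℝ} (hm : 0 ≤ m) (ha : 0 < a) :
    (n * (m / a) ^ 2) ^ (n / 2) = n ^ (n / 2) * m ^ n * a ^ (-n) := by
  rw [Real.mul_rpow hn.le (by positivity), ← Real.rpow_natCast, ← Real.rpow_mul (by positivity),
    Real.div_rpow hm ha.le, Real.rpow_neg ha.le]
  have : ((2 : ℕ) : ℝ) * (n / 2) = n := by push_cast; ring
  rw [this]
  ring

lemma chiSqConst_div_studentTailConst {n : ℝ} (hn : 0 < n) :
    chiSqConst n * n ^ (n / 2) / studentTailConst n = 1 / normalMoment n := by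
  have h1 := Real.Gamma_pos_of_pos (half_pos hn)
  have h2 : 0 < Real.Gamma ((n + 1) / 2) := Real.Gamma_pos_of_pos (by linarith)
  have h3 := Real.pi_pos
  have e : n ^ ((n + 1) / 2) = n ^ (n / 2) * √n := by
    rw [Real.sqrt_eq_rpow, ← Real.rpow_add hn]; congr 1; ring
  rw [chiSqConst, studentTailConst, normalMoment, e, Real.sqrt_mul hn.le, add_comm 1 n]
  have h4 : 0 < √Real.pi := by positivity
  have h5 : 0 < √n := by positivity
  have h6 : 0 < n ^ (n / 2) := by positivity
  have h7 : (0 : ℝ) < 2 ^ (n / 2) := by positivity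
  field_simp

lemma tendsto_condTail_div {n : ℝ} (hn : 0 < n) (z : ℝ) :
    Tendsto (fun a => condTail n a z / studentCdf n (-a)) atTop (𝓝 (limitTail n z)) := by
  have hm : 0 ≤ max (-z) 0 := le_max_right _ _
  set m := max (-z) 0 with hmdef
  have hx : Tendsto (fun a : ℝ => n * (m / a) ^ 2) atTop (𝓝 0) := by
    have := ((tendsto_const_nhds (x := m)).div_atTop (tendsto_id (α := ℝ) (x := atTop))).pow 2
    simpa using this.const_mul n
  have hexp : Tendsto (fun a : ℝ => Real.exp (-(n * (m / a) ^ 2) / 2)) atTop (𝓝 1) := by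
    have := (hx.neg.div_const 2)
    simpa using this.rexp
  have h1 : Tendsto (fun a => condTail n a z * a ^ n) atTop
      (𝓝 (chiSqConst n * (n ^ (n / 2) * m ^ n))) := by
    have hl := hexp.mul_const (chiSqConst n * (n ^ (n / 2) * m ^ n))
    rw [one_mul] at hl
    refine tendsto_of_tendsto_of_tendsto_of_le_of_le' hl tendsto_const_nhds ?_ ?_
    all_goals
      filter_upwards [eventually_gt_atTop 0] with a ha
      have e : a ^ (-n) * a ^ n = 1 := by rw [← Real.rpow_add ha]; simp
      have hp : 0 < a ^ n := by positivity
    · have := mul_le_mul_of_nonneg_right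
        (le_cdf_chiSq hn (x := n * (m / a) ^ 2) (by positivity)) hp.le
      rwa [rpow_half_mul_sq hn hm ha, mul_assoc, mul_assoc, mul_assoc (n ^ (n / 2) * m ^ n), e,
        mul_one] at this
    · have := mul_le_mul_of_nonneg_right
        (cdf_chiSq_le hn (x := n * (m / a) ^ 2) (by positivity)) hp.le
      rwa [rpow_half_mul_sq hn hm ha, mul_assoc, mul_assoc (n ^ (n / 2) * m ^ n), e,
        mul_one] at this
  have h2 := h1.div (tendsto_studentCdf_mul_rpow hn) (studentTailConst_pos hn).ne'
  have e : chiSqConst n * (n ^ (n / 2) * m ^ n) / studentTailConst n = limitTail n z := by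
    have := chiSqConst_div_studentTailConst hn
    rw [limitTail, ← mul_assoc, mul_div_right_comm, this, ← hmdef]
    ring
  rw [e] at h2
  refine h2.congr' ?_
  filter_upwards [eventually_gt_atTop 0] with a ha
  have hp : 0 < a ^ n := by positivity
  exact mul_div_mul_right _ _ hp.ne'

/-- Domination of the conditional tail probabilities by a power. -/
lemma exists_condTail_div_le {n : ℝ} (hn : 0 < n) :
    ∃ K : ℝ, ∀ a, 1 ≤ a → ∀ z, condTail n a z / studentCdf n (-a) ≤ K * limitTail n z := by
  have hc := studentTailConst_pos hn
  have hk := chiSqConst_pos hn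
  have hM := normalMoment_pos hn
  -- Quotient of the upper chi-square bound by the lower Student bound, whose correction factor is
  -- smallest at `a = 1`; the powers of `a` cancel.
  refine ⟨chiSqConst n * n ^ (n / 2) * normalMoment n /
    ((1 + n) ^ (-(n + 1) / 2) * studentTailConst n), fun a ha z => ?_⟩
  have ha0 : 0 < a := by linarith
  have hm : 0 ≤ max (-z) 0 := le_max_right _ _
  have h1 : condTail n a z ≤ chiSqConst n * (n ^ (n / 2) * max (-z) 0 ^ n * a ^ (-n)) := by
    rw [← rpow_half_mul_sq hn hm ha0]
    exact cdf_chiSq_le hn (by positivity)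
  have h2 : (1 + n) ^ (-(n + 1) / 2) * (studentTailConst n * a ^ (-n)) ≤ studentCdf n (-a) := by
    refine le_trans ?_ (le_studentCdf_neg hn ha0)
    refine mul_le_mul_of_nonneg_right ?_ (by positivity)
    refine Real.rpow_le_rpow_of_nonpos (by positivity) ?_ (by linarith)
    have : n / a ^ 2 ≤ n := div_le_self hn.le (by nlinarith)
    linarith
  have h3 : 0 < a ^ (-n) := by positivity
  refine (div_le_div₀ (by positivity) h1 (by positivity) h2).trans_eq ?_
  rw [limitTail]
  field_simp

/-! ### The bivariate normal law in linear coordinates. -/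

lemma posSemidef_corrMatrix {ρ : ℝ} (hρ : -1 < ρ) (hρ' : ρ < 1) :
    (!![1, ρ; ρ, 1] : Matrix (Fin 2) (Fin 2) ℝ).PosSemidef := by
  refine Matrix.PosSemidef.of_dotProduct_mulVec_nonneg ?_ fun x => ?_
  · ext i j
    fin_cases i <;> fin_cases j <;> simp
  · simp only [Matrix.mulVec, dotProduct, Fin.sum_univ_two, star_trivial, Matrix.of_apply,
      Matrix.cons_val', Matrix.cons_val_zero, Matrix.cons_val_one, Matrix.cons_val_fin_one]
    -- The quadratic form is `(x₀ + ρ x₁)² + (1 - ρ²) x₁²`.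
    nlinarith [sq_nonneg (x 0 + ρ * x 1),
      mul_nonneg (by nlinarith : 0 ≤ 1 - ρ ^ 2) (sq_nonneg (x 1))]

lemma charFun_map_gaussian_linear (a b c d : ℝ) (t : EuclideanSpace ℝ (Fin 2)) :
    charFun (((gaussianReal 0 1).prod (gaussianReal 0 1)).map
      (fun p : ℝ × ℝ => !₂[a * p.1 + b * p.2, c * p.1 + d * p.2])) t =
      Complex.exp (-(((a * t 0 + c * t 1) ^ 2 + (b * t 0 + d * t 1) ^ 2 : ℝ) : ℂ) / 2) := by
  rw [charFun_apply, integral_map (by fun_prop) (by fun_prop)]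
  have e : ∀ p : ℝ × ℝ,
      Complex.exp (inner ℝ (!₂[a * p.1 + b * p.2, c * p.1 + d * p.2] : EuclideanSpace ℝ (Fin 2)) t *
        Complex.I) =
      Complex.exp (((a * t 0 + c * t 1 : ℝ) : ℂ) * p.1 * Complex.I) *
        Complex.exp (((b * t 0 + d * t 1 : ℝ) : ℂ) * p.2 * Complex.I) := fun p => by
    rw [← Complex.exp_add]
    congr 1
    simp only [PiLp.inner_apply, Fin.sum_univ_two, RCLike.inner_apply, conj_trivial]
    simp
    ring
  simp_rw [e]
  rw [integral_prod_mul (fun x : ℝ => Complex.exp (((a * t 0 + c * t 1 : ℝ) : ℂ) * x * Complex.I))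
    (fun x : ℝ => Complex.exp (((b * t 0 + d * t 1 : ℝ) : ℂ) * x * Complex.I)),
    ← charFun_apply_real, ← charFun_apply_real, charFun_gaussianReal, charFun_gaussianReal,
    ← Complex.exp_add]
  congr 1
  push_cast
  ring

/-- A linear image of two independent standard normal variables with the right covariances has
the law `bivNormal ρ`. -/
lemma bivNormal_eq_map {ρ : ℝ} (hρ : -1 < ρ) (hρ' : ρ < 1) {a b c d : ℝ} (h₁ : a ^ 2 + b ^ 2 = 1)
    (h₂ : c ^ 2 + d ^ 2 = 1) (h₃ : a * c + b * d = ρ) :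
    bivNormal ρ = ((gaussianReal 0 1).prod (gaussianReal 0 1)).map
      (fun p : ℝ × ℝ => !₂[a * p.1 + b * p.2, c * p.1 + d * p.2]) := by
  have : IsProbabilityMeasure (((gaussianReal 0 1).prod (gaussianReal 0 1)).map
      (fun p : ℝ × ℝ => (!₂[a * p.1 + b * p.2, c * p.1 + d * p.2] : EuclideanSpace ℝ (Fin 2)))) :=
    Measure.isProbabilityMeasure_map (by fun_prop)
  refine Measure.ext_of_charFun (funext fun t => ?_)
  rw [charFun_map_gaussian_linear, bivNormal,
    charFun_multivariateGaussian (posSemidef_corrMatrix hρ hρ')]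
  congr 1
  simp only [Matrix.mulVec, dotProduct, Fin.sum_univ_two, Matrix.of_apply, inner_zero_right,
      Matrix.cons_val', Matrix.cons_val_zero, Matrix.cons_val_one, Matrix.cons_val_fin_one]
  have e : (a * t 0 + c * t 1) ^ 2 + (b * t 0 + d * t 1) ^ 2 =
      t 0 * (1 * t 0 + ρ * t 1) + t 1 * (ρ * t 0 + 1 * t 1) := by
    linear_combination (t 0 ^ 2) * h₁ + (t 1 ^ 2) * h₂ + 2 * t 0 * t 1 * h₃
  rw [e]
  push_cast
  ring

/-- `z⁻ ≤ |z|`, and a normal variable has finite absolute moments of every order. -/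
lemma integrable_limitTail {n : ℝ} (hn : 0 < n) : Integrable (limitTail n) (gaussianReal 0 1) := by
  have h := (memLp_id_gaussianReal (μ := 0) (v := 1) n.toNNReal).integrable_norm_rpow
    (by simpa using hn) ENNReal.coe_ne_top
  simp only [id, ENNReal.coe_toReal, Real.coe_toNNReal _ hn.le] at h
  refine (h.div_const (normalMoment n)).mono (measurable_limitTail n).aestronglyMeasurable
    (ae_of_all _ fun z => ?_)
  have hM := normalMoment_pos hn
  have h0 : 0 ≤ max (-z) 0 := le_max_right _ _
  rw [Real.norm_of_nonneg (limitTail_nonneg hn z), Real.norm_of_nonneg (by positivity), limitTail]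
  gcongr
  exact max_le (neg_le_abs z) (abs_nonneg z)

lemma integrable_limitTail_bivNormal {ρ : ℝ} (hρ : -1 < ρ) (hρ' : ρ < 1) {n : ℝ} (hn : 0 < n)
    (i : Fin 2) : Integrable (fun z => limitTail n (z i)) (bivNormal ρ) := by
  have h := measurePreserving_eval_multivariateGaussian (μ := 0) (posSemidef_corrMatrix hρ hρ')
    (i := i)
  have e : (!![1, ρ; ρ, 1] : Matrix (Fin 2) (Fin 2) ℝ) i i = 1 := by fin_cases i <;> rfl
  rw [e, Real.toNNReal_one] at h
  exact h.integrable_comp_of_integrable (by simpa using integrable_limitTail hn)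

/-! ### The expectation of the minimum of the limits. -/

lemma normalMoment_div_rpow {ν₁ ν₂ : ℝ} (h₁ : 0 < ν₁) :
    (normalMoment ν₂ / normalMoment ν₁) ^ (1 / ν₂) = tailB ν₁ ν₂ := by
  have h2 : 0 < Real.Gamma ((1 + ν₁) / 2) := Real.Gamma_pos_of_pos (by linarith)
  have h3 := Real.pi_pos
  rw [tailB, normalMoment, normalMoment]
  congr 1
  field_simp

lemma tailB_pos {ν₁ ν₂ : ℝ} (h₁ : 0 < ν₁) (h₂ : 0 < ν₂) : 0 < tailB ν₁ ν₂ := by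
  rw [← normalMoment_div_rpow h₁]
  have := normalMoment_pos h₁
  have := normalMoment_pos h₂
  positivity

lemma limitTail_neg_of_nonneg (n : ℝ) {x : ℝ} (hx : 0 ≤ x) :
    limitTail n (-x) = x ^ n / normalMoment n := by
  rw [limitTail, neg_neg, max_eq_left hx]

lemma limitTail_of_nonneg {n : ℝ} (hn : 0 < n) {x : ℝ} (hx : 0 ≤ x) : limitTail n x = 0 := by
  rw [limitTail, max_eq_right (neg_nonpos.2 hx), Real.zero_rpow hn.ne', zero_div]

/-- `B x^{ν₁/ν₂}` is where the second limit reaches the level of the first at `x`. Comparing the two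
limits thus becomes a linear inequality in the second normal variable. -/
lemma limitTail_neg_eq {ν₁ ν₂ : ℝ} (h₁ : 0 < ν₁) (h₂ : 0 < ν₂) {x : ℝ} (hx : 0 < x) :
    limitTail ν₁ (-x) = limitTail ν₂ (-(tailB ν₁ ν₂ * x ^ (ν₁ / ν₂))) := by
  have hB := tailB_pos h₁ h₂
  have hM₁ := normalMoment_pos h₁
  have hM₂ := normalMoment_pos h₂
  rw [limitTail_neg_of_nonneg _ hx.le, limitTail_neg_of_nonneg _ (by positivity),
    Real.mul_rpow hB.le (by positivity), ← Real.rpow_mul hx.le, div_mul_cancel₀ _ h₂.ne',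
    ← normalMoment_div_rpow h₁, ← Real.rpow_mul (by positivity), one_div_mul_cancel h₂.ne',
    Real.rpow_one]
  field_simp

lemma limitTail_neg_lt_iff {n : ℝ} (hn : 0 < n) {c : ℝ} (hc : 0 < c) (w : ℝ) :
    limitTail n (-c) < limitTail n w ↔ w < -c := by
  rw [limitTail_neg_of_nonneg _ hc.le, limitTail,
    div_lt_div_iff_of_pos_right (normalMoment_pos hn),
    Real.rpow_lt_rpow_iff hc.le (le_max_right _ _) hn, lt_max_iff, lt_neg]
  simp [hc.le]

lemma limitTail_neg_le_iff {n : ℝ} (hn : 0 < n) {c : ℝ} (hc : 0 < c) (w : ℝ) :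
    limitTail n (-c) ≤ limitTail n w ↔ w ≤ -c := by
  rw [limitTail_neg_of_nonneg _ hc.le, limitTail,
    div_le_div_iff_of_pos_right (normalMoment_pos hn),
    Real.rpow_le_rpow_iff hc.le (le_max_right _ _) hn, le_max_iff, le_neg]
  simp [hc]

/-- The set of those second normal variables for which the first component attains the minimum. -/
lemma gaussianReal_real_of_rel {ρ : ℝ} (hρ : -1 < ρ) (hρ' : ρ < 1) {ν₁ ν₂ : ℝ} (h₁ : 0 < ν₁)
    (h₂ : 0 < ν₂) {R : Set (ℝ × ℝ)} (hlt : ∀ x y, x < y → (x, y) ∈ R)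
    (hle : ∀ x y, (x, y) ∈ R → x ≤ y) {x : ℝ} (hx : 0 < x) :
    (gaussianReal 0 1).real
      {v | (limitTail ν₁ (-x), limitTail ν₂ (-ρ * x + √(1 - ρ ^ 2) * v)) ∈ R} =
      normalCdf (-(tailB ν₁ ν₂ * x ^ (ν₁ / ν₂) - ρ * x) / √(1 - ρ ^ 2)) := by
  have hσ : 0 < √(1 - ρ ^ 2) := Real.sqrt_pos.2 (by nlinarith)
  have hc : 0 < tailB ν₁ ν₂ * x ^ (ν₁ / ν₂) := mul_pos (tailB_pos h₁ h₂) (by positivity)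
  set b := -(tailB ν₁ ν₂ * x ^ (ν₁ / ν₂) - ρ * x) / √(1 - ρ ^ 2) with hb
  have hI : (gaussianReal 0 1).real (Iic b) = normalCdf b := (cdf_eq_real _ _).symm
  -- The set lies between `Iio b` and `Iic b`, which have equal mass because the normal law has no
  -- atoms.
  have := nullSingletonClass_gaussianReal (μ := 0) (one_ne_zero (α := NNReal))
  refine le_antisymm ?_ ?_
  · rw [← hI]
    refine measureReal_mono fun v hv => ?_
    have := hle _ _ hv
    rw [limitTail_neg_eq h₁ h₂ hx, limitTail_neg_le_iff h₂ hc] at this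
    rw [mem_Iic, hb, le_div_iff₀ hσ]
    linarith
  · rw [← hI, ← measureReal_congr Iio_ae_eq_Iic]
    refine measureReal_mono fun v hv => hlt _ _ ?_
    rw [limitTail_neg_eq h₁ h₂ hx, limitTail_neg_lt_iff h₂ hc]
    rw [mem_Iio, hb, lt_div_iff₀ hσ] at hv
    linarith

/-- The factor `2 * x` is the Jacobian of `t = x²`. -/
lemma two_mul_chiSqPdf_sq {n : ℝ} (hn : 0 < n) {x : ℝ} (hx : 0 < x) :
    2 * x * chiSqPdf (n + 1) (x ^ 2) = gaussianPDFReal 0 1 x * (x ^ n / normalMoment n) := by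
  have h2 : 0 < Real.Gamma ((1 + n) / 2) := Real.Gamma_pos_of_pos (by linarith)
  have h3 := Real.pi_pos
  have e1 : (x ^ 2) ^ ((n + 1) / 2 - 1) = x ^ n / x := by
    rw [← Real.rpow_natCast, ← Real.rpow_mul hx.le, ← Real.rpow_sub_one hx.ne']
    congr 1; push_cast; ring
  have e2 : (2 : ℝ) ^ ((n + 1) / 2) = 2 ^ (n / 2) * √2 := by
    rw [Real.sqrt_eq_rpow, ← Real.rpow_add zero_lt_two]; congr 1; ring
  rw [chiSqPdf, e1, e2, gaussianPDFReal, normalMoment, add_comm n 1, NNReal.coe_one, sub_zero,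
    mul_one, mul_one, Real.sqrt_mul zero_le_two]
  field_simp

lemma tailOmega_eq_integral (ρ : ℝ) {ν₁ ν₂ : ℝ} (h₁ : 0 < ν₁) (h₂ : 0 < ν₂) :
    tailOmega ρ ν₁ ν₂ = ∫ x in Ioi (0 : ℝ), gaussianPDFReal 0 1 x * (x ^ ν₁ / normalMoment ν₁ *
      normalCdf (-(tailB ν₁ ν₂ * x ^ (ν₁ / ν₂) - ρ * x) / √(1 - ρ ^ 2))) := by
  rw [tailOmega, ← integral_comp_rpow_Ioi_of_pos zero_lt_two]
  refine setIntegral_congr_fun measurableSet_Ioi fun x hx => ?_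
  rw [mem_Ioi] at hx
  have e1 : (x ^ 2) ^ (ν₁ / (2 * ν₂)) = x ^ (ν₁ / ν₂) := by
    rw [← Real.rpow_natCast, ← Real.rpow_mul hx.le]; congr 1; push_cast; field_simp
  have e2 : (2 : ℝ) - 1 = 1 := by norm_num
  simp only [smul_eq_mul, e2, Real.rpow_one, Real.rpow_two, omegaIntegrand]
  rw [← mul_assoc, two_mul_chiSqPdf_sq h₁ hx, e1, Real.sqrt_sq hx.le]
  ring

/-- Fubini, with the inner integral supplied by `gaussianReal_real_of_rel`. The relation `R` is free
between `<` and `≤` so that ties can be counted in just one of the two halves of the minimum. -/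
lemma integral_indicator_limitTail {ρ : ℝ} (hρ : -1 < ρ) (hρ' : ρ < 1) {ν₁ ν₂ : ℝ} (h₁ : 0 < ν₁)
    (h₂ : 0 < ν₂) {R : Set (ℝ × ℝ)} (hR : MeasurableSet R) (hlt : ∀ x y, x < y → (x, y) ∈ R)
    (hle : ∀ x y, (x, y) ∈ R → x ≤ y) :
    ∫ p : ℝ × ℝ, R.indicator Prod.fst
      (limitTail ν₁ (-p.1), limitTail ν₂ (-ρ * p.1 + √(1 - ρ ^ 2) * p.2))
      ∂((gaussianReal 0 1).prod (gaussianReal 0 1)) = tailOmega ρ ν₁ ν₂ := by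
  have m₁ := measurable_limitTail ν₁
  have m₂ := measurable_limitTail ν₂
  have hpair : Measurable fun p : ℝ × ℝ =>
      (limitTail ν₁ (-p.1), limitTail ν₂ (-ρ * p.1 + √(1 - ρ ^ 2) * p.2)) := by fun_prop
  have hmeas : Measurable fun p : ℝ × ℝ => R.indicator Prod.fst
      (limitTail ν₁ (-p.1), limitTail ν₂ (-ρ * p.1 + √(1 - ρ ^ 2) * p.2)) :=
    (measurable_fst.indicator hR).comp hpair
  have hneg : Integrable (fun x => limitTail ν₁ (-x)) (gaussianReal 0 1) := by
    have h : MeasurePreserving (fun x : ℝ => -x) (gaussianReal 0 1) (gaussianReal 0 1) :=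
      ⟨measurable_neg, by simpa using gaussianReal_map_neg (μ := 0) (v := 1)⟩
    exact h.integrable_comp_of_integrable (integrable_limitTail h₁)
  have hint : Integrable (fun p : ℝ × ℝ => R.indicator Prod.fst
      (limitTail ν₁ (-p.1), limitTail ν₂ (-ρ * p.1 + √(1 - ρ ^ 2) * p.2)))
      ((gaussianReal 0 1).prod (gaussianReal 0 1)) := by
    refine Integrable.mono (hneg.comp_fst (gaussianReal 0 1)) hmeas.aestronglyMeasurable
      (ae_of_all _ fun p => ?_)
    exact norm_indicator_le_norm_self (f := (Prod.fst : ℝ × ℝ → ℝ)) _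
  have hin : ∀ x, ∫ v, R.indicator Prod.fst
      (limitTail ν₁ (-x), limitTail ν₂ (-ρ * x + √(1 - ρ ^ 2) * v)) ∂(gaussianReal 0 1) =
      limitTail ν₁ (-x) * (gaussianReal 0 1).real
        {v | (limitTail ν₁ (-x), limitTail ν₂ (-ρ * x + √(1 - ρ ^ 2) * v)) ∈ R} := fun x => by
    have hs : MeasurableSet
        {v | (limitTail ν₁ (-x), limitTail ν₂ (-ρ * x + √(1 - ρ ^ 2) * v)) ∈ R} :=
      (hpair.comp measurable_prodMk_left) hR
    have h := integral_indicator_const (μ := gaussianReal 0 1) (limitTail ν₁ (-x)) hs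
    exact h.trans (mul_comm _ _)
  rw [integral_prod _ hint, tailOmega_eq_integral ρ h₁ h₂]
  simp_rw [hin]
  rw [integral_gaussianReal_eq_integral_smul one_ne_zero,
    ← setIntegral_eq_integral_of_forall_compl_eq_zero (s := Ioi 0)]
  · refine setIntegral_congr_fun measurableSet_Ioi fun x hx => ?_
    rw [mem_Ioi] at hx
    simp only [smul_eq_mul]
    rw [gaussianReal_real_of_rel hρ hρ' h₁ h₂ hlt hle hx, limitTail_neg_of_nonneg _ hx.le]
  · intro x hx
    rw [limitTail_of_nonneg h₁ (by simpa using hx), zero_mul, smul_zero]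

lemma integral_min_limitTail {ρ : ℝ} (hρ : -1 < ρ) (hρ' : ρ < 1) {ν₁ ν₂ : ℝ} (h₁ : 0 < ν₁)
    (h₂ : 0 < ν₂) :
    ∫ z, min (limitTail ν₁ (z 0)) (limitTail ν₂ (z 1)) ∂(bivNormal ρ) =
      tailOmega ρ ν₁ ν₂ + tailOmega ρ ν₂ ν₁ := by
  have m₁ := measurable_limitTail ν₁
  have m₂ := measurable_limitTail ν₂
  have hσ : √(1 - ρ ^ 2) ^ 2 = 1 - ρ ^ 2 := Real.sq_sqrt (by nlinarith)
  have mle : MeasurableSet {p : ℝ × ℝ | p.1 ≤ p.2} := measurableSet_le measurable_fst measurable_snd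
  have mlt : MeasurableSet {p : ℝ × ℝ | p.1 < p.2} := measurableSet_lt measurable_fst measurable_snd
  have hmeas₁ : Measurable fun z : EuclideanSpace ℝ (Fin 2) =>
      {p : ℝ × ℝ | p.1 ≤ p.2}.indicator Prod.fst (limitTail ν₁ (z 0), limitTail ν₂ (z 1)) :=
    (measurable_fst.indicator mle).comp (by fun_prop)
  have hmeas₂ : Measurable fun z : EuclideanSpace ℝ (Fin 2) =>
      {p : ℝ × ℝ | p.1 < p.2}.indicator Prod.fst (limitTail ν₂ (z 1), limitTail ν₁ (z 0)) :=
    (measurable_fst.indicator mlt).comp (by fun_prop)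
  have hsplit : ∀ z : EuclideanSpace ℝ (Fin 2), min (limitTail ν₁ (z 0)) (limitTail ν₂ (z 1)) =
      {p : ℝ × ℝ | p.1 ≤ p.2}.indicator Prod.fst (limitTail ν₁ (z 0), limitTail ν₂ (z 1)) +
      {p : ℝ × ℝ | p.1 < p.2}.indicator Prod.fst (limitTail ν₂ (z 1), limitTail ν₁ (z 0)) := by
    intro z
    rcases le_or_gt (limitTail ν₁ (z 0)) (limitTail ν₂ (z 1)) with h | h
    · simp [indicator, h, h.not_gt]
    · simp [indicator, h, h.le, h.not_ge]
  simp_rw [hsplit]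
  rw [integral_add]
  · congr 1
    -- In each half, coordinates are chosen so that the component attaining the minimum is minus the
    -- first independent normal.
    · rw [bivNormal_eq_map hρ hρ' (a := -1) (b := 0) (c := -ρ) (d := √(1 - ρ ^ 2)) (by norm_num)
        (by rw [hσ]; ring) (by ring), integral_map (by fun_prop) hmeas₁.aestronglyMeasurable,
        ← integral_indicator_limitTail hρ hρ' h₁ h₂ mle (fun x y h => le_of_lt h) (fun x y h => h)]
      simp
    · rw [bivNormal_eq_map hρ hρ' (a := -ρ) (b := √(1 - ρ ^ 2)) (c := -1) (d := 0)
        (by rw [hσ]; ring) (by norm_num) (by ring),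
        integral_map (by fun_prop) hmeas₂.aestronglyMeasurable,
        ← integral_indicator_limitTail hρ hρ' h₂ h₁ mlt (fun x y h => h) (fun x y h => le_of_lt h)]
      simp
  · exact (integrable_limitTail_bivNormal hρ hρ' h₁ 0).mono hmeas₁.aestronglyMeasurable
      (ae_of_all _ fun z => norm_indicator_le_norm_self (f := (Prod.fst : ℝ × ℝ → ℝ)) _)
  · exact (integrable_limitTail_bivNormal hρ hρ' h₂ 1).mono hmeas₂.aestronglyMeasurable
      (ae_of_all _ fun z => norm_indicator_le_norm_self (f := (Prod.fst : ℝ × ℝ → ℝ)) _)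

/-! ### The lower tail coefficient. -/

/-- Student quantiles near zero, as a function of the level. -/
lemma exists_quantile {n : ℝ} (hn : 0 < n) :
    ∃ a : ℝ → ℝ, (∀ᶠ q in 𝓝[>] 0, 0 < a q ∧ studentCdf n (-a q) = q) ∧
      Tendsto a (𝓝[>] 0) atTop := by
  have h : ∀ q, ∃ a, 0 < q → q < studentCdf n 0 → 0 < a ∧ studentCdf n (-a) = q := fun q => by
    by_cases hq : 0 < q ∧ q < studentCdf n 0
    · obtain ⟨a, ha⟩ := exists_studentCdf_neg_eq hn hq.1 hq.2
      exact ⟨a, fun _ _ => ha⟩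
    · exact ⟨0, fun h1 h2 => absurd ⟨h1, h2⟩ hq⟩
  choose a ha using h
  have hsmall : ∀ x, ∀ᶠ q in 𝓝[>] (0 : ℝ), q < studentCdf n x := fun x =>
    mem_nhdsWithin_of_mem_nhds (Iio_mem_nhds (studentCdf_pos hn x))
  have hev : ∀ᶠ q in 𝓝[>] 0, 0 < a q ∧ studentCdf n (-a q) = q := by
    filter_upwards [hsmall 0, self_mem_nhdsWithin] with q h1 h2 using ha q h2 h1
  refine ⟨a, hev, tendsto_atTop.2 fun M => ?_⟩
  filter_upwards [hev, hsmall (-M)] with q h1 h2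
  rw [← h1.2, (strictMono_studentCdf hn).lt_iff_lt] at h2
  linarith

theorem hasLowerTDC_copulaLaw {ρ : ℝ} (hρ : -1 < ρ) (hρ' : ρ < 1) {ν₁ ν₂ : ℝ} (h₁ : 0 < ν₁)
    (h₂ : 0 < ν₂) :
    HasLowerTDC (copulaLaw ρ ν₁ ν₂) (tailOmega ρ ν₁ ν₂ + tailOmega ρ ν₂ ν₁) := by
  obtain ⟨a₁, ha₁, ht₁⟩ := exists_quantile h₁
  obtain ⟨a₂, ha₂, ht₂⟩ := exists_quantile h₂
  obtain ⟨K, hK⟩ := exists_condTail_div_le h₁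
  rw [HasLowerTDC, ← integral_min_limitTail hρ hρ' h₁ h₂]
  have key : Tendsto (fun q => ∫ z, min (condTail ν₁ (a₁ q) (z 0) / studentCdf ν₁ (-a₁ q))
      (condTail ν₂ (a₂ q) (z 1) / studentCdf ν₂ (-a₂ q)) ∂(bivNormal ρ)) (𝓝[>] 0)
      (𝓝 (∫ z, min (limitTail ν₁ (z 0)) (limitTail ν₂ (z 1)) ∂(bivNormal ρ))) := by
    -- A minimum is at most its first entry, so dominating the first ratio suffices.
    refine tendsto_integral_filter_of_dominated_convergence (fun z => K * limitTail ν₁ (z 0))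
      (Eventually.of_forall fun q => ?_) ?_
      ((integrable_limitTail_bivNormal hρ hρ' h₁ 0).const_mul K) (ae_of_all _ fun z => ?_)
    · have m₁ := measurable_condTail ν₁ (a₁ q)
      have m₂ := measurable_condTail ν₂ (a₂ q)
      exact Measurable.aestronglyMeasurable (by fun_prop)
    · filter_upwards [ht₁.eventually_ge_atTop 1] with q hq
      refine ae_of_all _ fun z => ?_
      rw [Real.norm_of_nonneg (le_min
        (div_nonneg (condTail_nonneg _ _ _) (studentCdf_pos h₁ _).le)
        (div_nonneg (condTail_nonneg _ _ _) (studentCdf_pos h₂ _).le))]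
      exact (min_le_left _ _).trans (hK _ hq _)
    · exact ((tendsto_condTail_div h₁ (z 0)).comp ht₁).min
        ((tendsto_condTail_div h₂ (z 1)).comp ht₂)
  refine key.congr' ?_
  filter_upwards [ha₁, ha₂, self_mem_nhdsWithin] with q h1 h2 hq
  rw [jointCdf_copulaLaw ρ h₁ h₂ h1.1 h2.1 h1.2 h2.2, ← integral_div, h1.2, h2.2]
  simp_rw [min_div_div_right (le_of_lt (mem_Ioi.1 hq))]

/-! ### The upper tail coefficient by radial symmetry. -/

instance isFiniteMeasure_copulaLaw (ρ ν₁ ν₂ : ℝ) : IsFiniteMeasure (copulaLaw ρ ν₁ ν₂) := by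
  unfold copulaLaw baseLaw
  infer_instance

/-- Changing the sign of all four coefficients preserves the covariances, so `bivNormal_eq_map`
represents the same law. -/
lemma measurePreserving_neg_bivNormal {ρ : ℝ} (hρ : -1 < ρ) (hρ' : ρ < 1) :
    MeasurePreserving (fun z => -z) (bivNormal ρ) (bivNormal ρ) := by
  have hσ : √(1 - ρ ^ 2) ^ 2 = 1 - ρ ^ 2 := Real.sq_sqrt (by nlinarith)
  refine ⟨measurable_neg, ?_⟩
  conv_lhs => rw [bivNormal_eq_map hρ hρ' (a := 1) (b := 0) (c := ρ) (d := √(1 - ρ ^ 2))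
    (by norm_num) (by rw [hσ]; ring) (by ring)]
  rw [bivNormal_eq_map hρ hρ' (a := -1) (b := 0) (c := -ρ) (d := -√(1 - ρ ^ 2))
    (by norm_num) (by rw [neg_sq, neg_sq, hσ]; ring) (by ring),
    Measure.map_map measurable_neg (by fun_prop)]
  congr 1
  ext p i
  fin_cases i
  · simp
  · simp
    ring

lemma copulaVec_neg {ν₁ ν₂ : ℝ} (h₁ : 0 < ν₁) (h₂ : 0 < ν₂)
    (p : ℝ × EuclideanSpace ℝ (Fin 2)) :
    copulaVec ν₁ ν₂ (p.1, -p.2) = (1 - (copulaVec ν₁ ν₂ p).1, 1 - (copulaVec ν₁ ν₂ p).2) := by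
  simp only [copulaVec, PiLp.neg_apply, mul_neg, studentCdf_neg h₁, studentCdf_neg h₂]

/-- Radial symmetry of the copula. -/
lemma jointSurvival_copulaLaw {ρ : ℝ} (hρ : -1 < ρ) (hρ' : ρ < 1) {ν₁ ν₂ : ℝ} (h₁ : 0 < ν₁)
    (h₂ : 0 < ν₂) (q : ℝ) :
    jointSurvival (copulaLaw ρ ν₁ ν₂) q q =
      (copulaLaw ρ ν₁ ν₂).real (Iio (1 - q) ×ˢ Iio (1 - q)) := by
  have hT : MeasurePreserving (Prod.map id fun z => -z) (baseLaw ρ) (baseLaw ρ) :=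
    (MeasurePreserving.id _).prod (measurePreserving_neg_bivNormal hρ hρ')
  have hae := aemeasurable_copulaVec ρ h₁ h₂
  have hs : NullMeasurableSet (copulaVec ν₁ ν₂ ⁻¹' (Ioi q ×ˢ Ioi q)) (baseLaw ρ) :=
    hae.nullMeasurable (measurableSet_Ioi.prod measurableSet_Ioi)
  rw [jointSurvival, measureReal_def, measureReal_def, copulaLaw,
    Measure.map_apply_of_aemeasurable hae (measurableSet_Ioi.prod measurableSet_Ioi),
    Measure.map_apply_of_aemeasurable hae (measurableSet_Iio.prod measurableSet_Iio),
    ← hT.measure_preimage hs]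
  congr 2
  ext p
  have := copulaVec_neg h₁ h₂ p
  simp only [mem_preimage, mem_prod, mem_Ioi, mem_Iio, Prod.map, id, this, lt_sub_comm]

/-- Lower tail dependence may be computed with strict inequalities. -/
lemma HasLowerTDC.tendsto_Iio {μ : Measure (ℝ × ℝ)} [IsFiniteMeasure μ] {l : ℝ}
    (h : HasLowerTDC μ l) :
    Tendsto (fun q : ℝ => μ.real (Iio q ×ˢ Iio q) / q) (𝓝[>] 0) (𝓝 l) := by
  have hid : Tendsto (fun q : ℝ => q) (𝓝[>] 0) (𝓝 0) := tendsto_id.mono_left nhdsWithin_le_nhds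
  have hlt : ∀ᶠ q : ℝ in 𝓝[>] 0, q < 1 := mem_nhdsWithin_of_mem_nhds (Iio_mem_nhds one_pos)
  -- The level `q * (1 - q)` is strictly below `q` but asymptotic to it, so the closed quadrant
  -- there fits inside the open one at `q` without changing the limit.
  have hsub : Tendsto (fun q : ℝ => q * (1 - q)) (𝓝[>] 0) (𝓝[>] 0) := by
    refine tendsto_nhdsWithin_iff.2 ⟨by simpa using hid.mul (hid.const_sub 1), ?_⟩
    filter_upwards [hlt, self_mem_nhdsWithin] with q h1 h2
    exact mul_pos (mem_Ioi.1 h2) (sub_pos.2 h1)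
  have hl := (Tendsto.comp h hsub).mul (hid.const_sub 1)
  rw [sub_zero, mul_one] at hl
  refine tendsto_of_tendsto_of_tendsto_of_le_of_le' hl h ?_ ?_
  · filter_upwards [hlt, self_mem_nhdsWithin] with q h1 h2
    have hq : (0 : ℝ) < q := h2
    have h3 : 1 - q ≠ 0 := (sub_pos.2 h1).ne'
    have e : jointCdf μ (q * (1 - q)) (q * (1 - q)) / (q * (1 - q)) * (1 - q) =
        jointCdf μ (q * (1 - q)) (q * (1 - q)) / q := by field_simp
    simp only [Function.comp_apply]
    rw [e, jointCdf]
    have h4 : q * (1 - q) < q := by nlinarith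
    exact div_le_div_of_nonneg_right (measureReal_mono
      (prod_mono (Iic_subset_Iio.2 h4) (Iic_subset_Iio.2 h4))) hq.le
  · filter_upwards [self_mem_nhdsWithin] with q h2
    exact div_le_div_of_nonneg_right (measureReal_mono
      (prod_mono Iio_subset_Iic_self Iio_subset_Iic_self)) (le_of_lt h2)

theorem hasUpperTDC_copulaLaw {ρ : ℝ} (hρ : -1 < ρ) (hρ' : ρ < 1) {ν₁ ν₂ : ℝ} (h₁ : 0 < ν₁)
    (h₂ : 0 < ν₂) :
    HasUpperTDC (copulaLaw ρ ν₁ ν₂) (tailOmega ρ ν₁ ν₂ + tailOmega ρ ν₂ ν₁) := by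
  have hsub : Tendsto (fun q : ℝ => 1 - q) (𝓝[<] 1) (𝓝[>] 0) := by
    refine tendsto_nhdsWithin_iff.2 ⟨?_, ?_⟩
    · simpa using (tendsto_id.mono_left (nhdsWithin_le_nhds (a := (1 : ℝ)))).const_sub 1
    · filter_upwards [self_mem_nhdsWithin] with q hq
      exact sub_pos.2 (mem_Iio.1 hq)
  rw [HasUpperTDC]
  simp_rw [jointSurvival_copulaLaw hρ hρ' h₁ h₂]
  exact (hasLowerTDC_copulaLaw hρ hρ' h₁ h₂).tendsto_Iio.comp hsub

end MultiDofT

theorem mainTheorem3 (ρ : ℝ) (hρ : -1 < ρ) (hρ' : ρ < 1) :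
    (∀ ν₁ ν₂ : ℝ, 0 < ν₁ → 0 < ν₂ →
      IntegrableOn (MultiDofT.omegaIntegrand ρ ν₁ ν₂) (Ioi 0) ∧
      MultiDofT.HasLowerTDC (MultiDofT.copulaLaw ρ ν₁ ν₂)
        (MultiDofT.tailOmega ρ ν₁ ν₂ + MultiDofT.tailOmega ρ ν₂ ν₁) ∧
      MultiDofT.HasUpperTDC (MultiDofT.copulaLaw ρ ν₁ ν₂)
        (MultiDofT.tailOmega ρ ν₁ ν₂ + MultiDofT.tailOmega ρ ν₂ ν₁)) ∧
    (∀ ν : ℝ, 0 < ν →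
      MultiDofT.tailOmega ρ ν ν + MultiDofT.tailOmega ρ ν ν =
        2 * MultiDofT.studentCdf (ν + 1) (-√((ν + 1) * (1 - ρ) / (1 + ρ)))) := by
  refine ⟨fun ν₁ ν₂ h₁ h₂ => ⟨MultiDofT.integrableOn_omegaIntegrand ρ ν₂ h₁,
    MultiDofT.hasLowerTDC_copulaLaw hρ hρ' h₁ h₂, MultiDofT.hasUpperTDC_copulaLaw hρ hρ' h₁ h₂⟩,
    fun ν hν => ?_⟩
  rw [MultiDofT.tailOmega_self hρ hρ' hν]
  ring
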